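/- Let $\Omega\subseteq\mathbb{R}^d$ be a nonempty, bounded, connected, open set, with no regularity required of its boundary, let $\lambda_1,\lambda_2>0$ and $f\in L^1(\Omega)$. For $u\in L^1(\Omega)$ let $$|Du|(\Omega)=\sup\Big\{\int_\Omega u\,\operatorname{div}\varphi\,dx:\ \varphi\in C_c^1(\Omega;\mathbb{R}^d),\ |\varphi|\le 1\Big\}\in[0,\infty]$$ be its total variation, and let $BV(\Omega)$ be the set of $u\in L^1(\Omega)$ with $|Du|(\Omega)<\infty$. Let $u^*\in BV(\Omega)$ be a solution of the TV–IC problem $$\min_{u\in BV(\Omega),\ v\in L^1(\Omega)}\ |Du|(\Omega)+\lambda_1\|v\|_{L^1(\Omega)}+\frac{\lambda_2}{2}\|f-u-v\|_{L^2(\Omega)}^2,$$ that is, there is $v^*\in L^1(\Omega)$ such that $(u^*,v^*)$ is a minimiser (the last term is $+\infty$ when $f-u-v\notin L^2(\Omega)$). Then $u^*=f$ a.e. in $\Omega$ if and only if $f$ is (a.e. equal to) a constant. In particular, the TV–IC model never recovers non-constant data exactly. -/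

import Mathlib

open MeasureTheory
open scoped ENNReal

namespace TVIC

/-- The divergence `∑ i, ∂φ_i/∂x_i` of a vector field on `ℝ^d`. -/
noncomputable def divergence {d : ℕ}
    (φ : EuclideanSpace ℝ (Fin d) → EuclideanSpace ℝ (Fin d))
    (x : EuclideanSpace ℝ (Fin d)) : ℝ :=
  ∑ i : Fin d, fderiv ℝ φ x (EuclideanSpace.single i 1) i

/-- The vector fields `φ ∈ C_c^1(Ω; ℝ^d)` with `|φ(x)| ≤ 1` (Euclidean norm) for all `x`. -/
structure IsTestField {d : ℕ} (Ω : Set (EuclideanSpace ℝ (Fin d)))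
    (φ : EuclideanSpace ℝ (Fin d) → EuclideanSpace ℝ (Fin d)) : Prop where
  contDiff : ContDiff ℝ 1 φ
  hasCompactSupport : HasCompactSupport φ
  tsupport_subset : tsupport φ ⊆ Ω
  norm_le_one : ∀ x, ‖φ x‖ ≤ 1

/-- The total variation `|Du|(Ω) ∈ [0, ∞]`: the supremum of `∫_Ω u div φ dx` over the fields
`φ ∈ C_c^1(Ω; ℝ^d)` with `|φ| ≤ 1`. The zero field is admissible, so cutting the integrals off at
`0` does not change the supremum. -/
noncomputable def totalVariation {d : ℕ} (Ω : Set (EuclideanSpace ℝ (Fin d)))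
    (u : EuclideanSpace ℝ (Fin d) → ℝ) : ℝ≥0∞ :=
  ⨆ (φ : EuclideanSpace ℝ (Fin d) → EuclideanSpace ℝ (Fin d)) (_ : IsTestField Ω φ),
    ENNReal.ofReal (∫ x in Ω, u x * divergence φ x)

/-- `u ∈ BV(Ω)`: `u ∈ L^1(Ω)` and `|Du|(Ω) < ∞`. -/
def IsBV {d : ℕ} (Ω : Set (EuclideanSpace ℝ (Fin d)))
    (u : EuclideanSpace ℝ (Fin d) → ℝ) : Prop :=
  IntegrableOn u Ω ∧ totalVariation Ω u < ∞

/-- The energy `|Du|(Ω) + lam1 ‖v‖_{L^1(Ω)} + (lam2 / 2) ‖f - u - v‖_{L^2(Ω)}^2 ∈ [0, ∞]`.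
The last term is `∞` when `f - u - v` is not in `L^2(Ω)`. -/
noncomputable def energy {d : ℕ} (Ω : Set (EuclideanSpace ℝ (Fin d))) (lam1 lam2 : ℝ)
    (f u v : EuclideanSpace ℝ (Fin d) → ℝ) : ℝ≥0∞ :=
  totalVariation Ω u
    + ENNReal.ofReal lam1 * eLpNorm v 1 (volume.restrict Ω)
    + ENNReal.ofReal (lam2 / 2) * eLpNorm (fun x => f x - u x - v x) 2 (volume.restrict Ω) ^ 2

/-- `(u, v)` solves `min |Du|(Ω) + lam1 ‖v‖_{L^1(Ω)} + (lam2 / 2) ‖f - u - v‖_{L^2(Ω)}^2` over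
`BV(Ω) × L^1(Ω)`. -/
def IsOptimalPair {d : ℕ} (Ω : Set (EuclideanSpace ℝ (Fin d))) (lam1 lam2 : ℝ)
    (f u v : EuclideanSpace ℝ (Fin d) → ℝ) : Prop :=
  IsBV Ω u ∧ IntegrableOn v Ω ∧
    ∀ w z : EuclideanSpace ℝ (Fin d) → ℝ, IsBV Ω w → IntegrableOn z Ω →
      energy Ω lam1 lam2 f u v ≤ energy Ω lam1 lam2 f w z

/-- `u` solves the TV-IC problem with data `f`: it is the first component of an optimal pair. -/
def IsSolution {d : ℕ} (Ω : Set (EuclideanSpace ℝ (Fin d))) (lam1 lam2 : ℝ)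
    (f u : EuclideanSpace ℝ (Fin d) → ℝ) : Prop :=
  ∃ v : EuclideanSpace ℝ (Fin d) → ℝ, IsOptimalPair Ω lam1 lam2 f u v

end TVIC

/-!
Constant data are recovered because the pair `(c, 0)` has energy `0`: every minimiser then has
energy `0`, which forces `v = 0` and `f - u - v = 0`.

Conversely, let `u = f` almost everywhere. A minimiser has energy at least `|Du|(Ω)`, so this number
bounds the minimal energy from below. Compare with the contracted function `(1 - t) u`, `0 < t ≤ 1`,
whose total variation is at most `(1 - t) |Du|(Ω)`. The residual `f - (1 - t) u = t u` need not be
square integrable; its part where `|t u| > 1` is therefore put into the `L¹` component and only the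
rest is left to the `L²` term. Dividing by `t` gives
`|Du|(Ω) ≤ ∫_{|t u| > 1} λ₁ |u| + ∫_{|t u| ≤ 1} (λ₂ / 2) t u²`
(`TVIC.totalVariation_le_lintegral_splitCost`). The integrand is dominated by `(λ₁ + λ₂ / 2) |u|`
and tends to `0` pointwise as `t → 0`, so `|Du|(Ω) = 0`
(`TVIC.totalVariation_eq_zero_of_ae_eq`).

A function of zero total variation on a connected open set is almost everywhere constant
(`TVIC.exists_ae_eq_const_of_totalVariation_eq_zero`): its distributional gradient vanishes, so its
mollifications are locally constant, and they converge to it almost everywhere.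
-/

open Filter Topology Convolution ContDiff

namespace TVIC

variable {d : ℕ}

local notation "E" d => EuclideanSpace ℝ (Fin d)

/-! ### Elementary properties of the total variation -/

theorem divergence_const_smul {φ : (E d) → E d} (hφ : Differentiable ℝ φ) (a : ℝ) (x : E d) :
    divergence (fun y => a • φ y) x = a * divergence φ x := by
  simp [divergence, fderiv_fun_const_smul (hφ x), Finset.mul_sum]

theorem divergence_smul_const {ψ : (E d) → ℝ} {x : E d} (hψ : DifferentiableAt ℝ ψ x) (v : E d) :
    divergence (fun y => ψ y • v) x = fderiv ℝ ψ x v := by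
  have hv : v = ∑ i, v i • EuclideanSpace.single i (1 : ℝ) := by
    simpa using ((EuclideanSpace.basisFun (Fin d) ℝ).sum_repr v).symm
  conv_rhs => rw [hv]
  simp [divergence, fderiv_smul_const hψ, mul_comm]

theorem totalVariation_congr_ae {Ω : Set (E d)} {u w : (E d) → ℝ}
    (h : u =ᵐ[volume.restrict Ω] w) : totalVariation Ω u = totalVariation Ω w := by
  unfold totalVariation
  refine iSup_congr fun φ => iSup_congr fun _ => congrArg _ (integral_congr_ae ?_)
  filter_upwards [h] with x hx
  rw [hx]

theorem totalVariation_const_mul_le (Ω : Set (E d)) {a : ℝ} (ha : 0 ≤ a) (u : (E d) → ℝ) :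
    totalVariation Ω (fun x => a * u x) ≤ ENNReal.ofReal a * totalVariation Ω u := by
  refine iSup₂_le fun φ hφ => ?_
  simp_rw [mul_assoc]
  rw [integral_const_mul, ENNReal.ofReal_mul ha]
  gcongr
  exact le_iSup₂ (f := fun φ (_ : IsTestField Ω φ) =>
    ENNReal.ofReal (∫ x in Ω, u x * divergence φ x)) φ hφ

theorem setIntegral_divergence_eq_zero {Ω : Set (E d)} {φ : (E d) → E d}
    (hφ : ContDiff ℝ 1 φ) (hc : HasCompactSupport φ) (hs : tsupport φ ⊆ Ω) :
    ∫ x in Ω, divergence φ x = 0 := by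
  have hdφ : Differentiable ℝ φ := hφ.differentiable one_ne_zero
  rw [setIntegral_eq_integral_of_forall_compl_eq_zero]
  · unfold divergence
    have hint : ∀ i : Fin d,
        Integrable fun x => fderiv ℝ φ x (EuclideanSpace.single i 1) i := fun i => by
      refine Continuous.integrable_of_hasCompactSupport ?_ ?_
      · have := hφ.continuous_fderiv one_ne_zero
        fun_prop
      · refine (hc.fderiv ℝ).comp_left
          (g := fun L : (E d) →L[ℝ] E d => L (EuclideanSpace.single i 1) i) ?_
        simp
    rw [integral_finsetSum _ fun i _ => hint i]
    refine Finset.sum_eq_zero fun i _ => ?_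
    have hφi : ContDiff ℝ 1 fun x => φ x i := by fun_prop
    have hder : ∀ x, fderiv ℝ (fun x => φ x i) x (EuclideanSpace.single i 1)
        = fderiv ℝ φ x (EuclideanSpace.single i 1) i := fun x => by
      have := ((EuclideanSpace.proj i : (E d) →L[ℝ] ℝ).hasFDerivAt.comp x
        (hdφ x).hasFDerivAt).fderiv
      exact congrArg (fun L : (E d) →L[ℝ] ℝ => L (EuclideanSpace.single i 1)) this
    have hφic : HasCompactSupport fun x => φ x i := hc.comp_left (g := fun y : E d => y i) rfl
    -- integration by parts against the constant function `1`
    have := integral_mul_fderiv_eq_neg_fderiv_mul_of_integrable (μ := (volume : Measure (E d)))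
      (f := fun _ => (1 : ℝ)) (g := fun x => φ x i) (v := EuclideanSpace.single i 1)
      (by simp) (by simpa [hder] using hint i)
      (by simpa using hφi.continuous.integrable_of_hasCompactSupport hφic)
      (by fun_prop) (fun x _ => hφi.differentiable one_ne_zero x)
    simpa [hder] using this
  · intro x hx
    have : fderiv ℝ φ x = 0 :=
      image_eq_zero_of_notMem_tsupport fun h => hx (hs (tsupport_fderiv_subset ℝ h))
    simp [divergence, this]

theorem totalVariation_const (Ω : Set (E d)) (c : ℝ) :
    totalVariation Ω (fun _ => c) = 0 := by
  refine le_antisymm (iSup₂_le fun φ hφ => ?_) zero_le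
  rw [integral_const_mul,
    setIntegral_divergence_eq_zero hφ.contDiff hφ.hasCompactSupport hφ.tsupport_subset]
  simp

/-! ### Functions of zero total variation -/

/-- If `|Du|(Ω) = 0` then the distributional gradient of `u` vanishes: rescaling makes the bound
`|φ| ≤ 1` harmless, and replacing `φ` by `-φ` turns the inequality into an equality. -/
theorem setIntegral_mul_divergence_eq_zero {Ω : Set (E d)} {u : (E d) → ℝ}
    (hu : totalVariation Ω u = 0) {φ : (E d) → E d}
    (hφ : ContDiff ℝ 1 φ) (hc : HasCompactSupport φ) (hs : tsupport φ ⊆ Ω) :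
    ∫ x in Ω, u x * divergence φ x = 0 := by
  obtain ⟨C, hC⟩ := hφ.continuous.bounded_above_of_compact_support hc
  have hC0 : 0 ≤ C := (norm_nonneg _).trans (hC 0)
  have key : ∀ a : ℝ, |a| ≤ (C + 1)⁻¹ → a * ∫ x in Ω, u x * divergence φ x ≤ 0 := by
    intro a ha
    have htest : IsTestField Ω (fun y => a • φ y) := by
      refine ⟨by fun_prop, hc.smul_left (f := fun _ => a),
        (tsupport_smul_subset_right (fun _ => a) φ).trans hs, fun x => ?_⟩
      rw [norm_smul, Real.norm_eq_abs]
      calc |a| * ‖φ x‖ ≤ (C + 1)⁻¹ * (C + 1) := by gcongr; linarith [hC x]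
        _ = 1 := inv_mul_cancel₀ (by positivity)
    have h := le_iSup₂ (f := fun φ (_ : IsTestField Ω φ) =>
      ENNReal.ofReal (∫ x in Ω, u x * divergence φ x)) _ htest
    change _ ≤ totalVariation Ω u at h
    rw [hu, nonpos_iff_eq_zero, ENNReal.ofReal_eq_zero] at h
    simp_rw [divergence_const_smul (hφ.differentiable one_ne_zero), mul_left_comm _ a] at h
    rwa [integral_const_mul] at h
  have hpos : 0 < (C + 1)⁻¹ := by positivity
  have h1 := key (C + 1)⁻¹ (abs_of_pos hpos).le
  have h2 := key (-(C + 1)⁻¹) (by rw [abs_neg, abs_of_pos hpos])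
  have h3 : (C + 1)⁻¹ * ∫ x in Ω, u x * divergence φ x = 0 := by linarith
  exact (mul_eq_zero.1 h3).resolve_left hpos.ne'

/-- Mollifying a function of zero total variation gives zero gradient at every point whose distance
to the complement of `Ω` exceeds the radius of the mollifier. -/
theorem hasFDerivAt_convolution_zero {Ω : Set (E d)} (hΩ : MeasurableSet Ω) {u : (E d) → ℝ}
    (hint : IntegrableOn u Ω) (hu : totalVariation Ω u = 0) {ρ : (E d) → ℝ}
    (hρ : ContDiff ℝ 1 ρ) {r : ℝ} (hsupp : tsupport ρ ⊆ Metric.closedBall 0 r) {x : E d}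
    (hx : Metric.closedBall x r ⊆ Ω) :
    HasFDerivAt (ρ ⋆[ContinuousLinearMap.lsmul ℝ ℝ, volume] Ω.indicator u)
      (0 : (E d) →L[ℝ] ℝ) x := by
  have hc : HasCompactSupport ρ :=
    (isCompact_closedBall (0 : E d) r).of_isClosed_subset (isClosed_tsupport ρ) hsupp
  have hloc : LocallyIntegrable (Ω.indicator u) volume :=
    ((integrable_indicator_iff hΩ).2 hint).locallyIntegrable
  have hder := hc.hasFDerivAt_convolution_left (ContinuousLinearMap.lsmul ℝ ℝ) hρ hloc x
  have hex := ((hc.fderiv ℝ).convolutionExists_left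
    ((ContinuousLinearMap.lsmul ℝ ℝ : ℝ →L[ℝ] ℝ →L[ℝ] ℝ).precompL (E d))
    (hρ.continuous_fderiv one_ne_zero) hloc x).integrable_swap
  suffices hgrad : (fderiv ℝ ρ ⋆[(ContinuousLinearMap.lsmul ℝ ℝ).precompL (E d), volume]
      Ω.indicator u) x = 0 by rwa [hgrad] at hder
  refine ContinuousLinearMap.ext fun v => ?_
  rw [convolution_eq_swap, ContinuousLinearMap.integral_apply hex]
  -- the field `t ↦ ρ (x - t) v` is admissible, and its divergence is `t ↦ -Dρ (x - t) v`
  have hψ : ContDiff ℝ 1 fun t => ρ (x - t) := by fun_prop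
  have hψs : tsupport (fun t => ρ (x - t)) ⊆ Metric.closedBall x r := by
    refine closure_minimal (fun t ht => ?_) Metric.isClosed_closedBall
    have := hsupp (subset_tsupport ρ ht)
    rwa [mem_closedBall_zero_iff, ← dist_eq_norm, dist_comm] at this
  have hφs : tsupport (fun t => ρ (x - t) • v) ⊆ Metric.closedBall x r :=
    (tsupport_smul_subset_left (fun t => ρ (x - t)) fun _ => v).trans hψs
  have hzero := setIntegral_mul_divergence_eq_zero hu (φ := fun t => ρ (x - t) • v) (by fun_prop)
    ((isCompact_closedBall x r).of_isClosed_subset (isClosed_tsupport _) hφs) (hφs.trans hx)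
  have hdiv : ∀ t, divergence (fun t => ρ (x - t) • v) t = -fderiv ℝ ρ (x - t) v := fun t => by
    rw [divergence_smul_const (hψ.differentiable one_ne_zero t)]
    have h := ((hρ.differentiable one_ne_zero (x - t)).hasFDerivAt.comp t
      ((hasFDerivAt_id t).const_sub x)).fderiv
    have h' := congrArg (fun L : (E d) →L[ℝ] ℝ => L v) h
    simpa [Function.comp_def] using h'
  simp_rw [hdiv, mul_neg, integral_neg, neg_eq_zero] at hzero
  rw [← integral_indicator hΩ] at hzero
  rw [zero_apply, ← hzero]
  refine integral_congr_ae (.of_forall fun t => ?_)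
  by_cases ht : t ∈ Ω <;> simp [ht, ContinuousLinearMap.precompL_apply, mul_comm]

/-- A function of zero total variation on a connected open set is almost everywhere constant: its
mollifications are locally constant away from the boundary, hence so is their limit, which agrees
with the function almost everywhere by Lebesgue differentiation. -/
theorem exists_ae_eq_const_of_totalVariation_eq_zero {Ω : Set (E d)} (hΩ : IsOpen Ω)
    (hconn : IsPreconnected Ω) {u : (E d) → ℝ} (hint : IntegrableOn u Ω)
    (hu : totalVariation Ω u = 0) : ∃ c : ℝ, ∀ᵐ x ∂(volume.restrict Ω), u x = c := by
  let ρ : ℕ → ContDiffBump (0 : E d) := fun n =>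
    ⟨1 / ((n : ℝ) + 1), 2 * (1 / ((n : ℝ) + 1)), by positivity,
      lt_two_mul_self (by positivity)⟩
  have hρlim : Tendsto (fun n => (ρ n).rOut) atTop (𝓝 0) := by
    simpa [ρ] using (tendsto_one_div_add_atTop_nhds_zero_nat (𝕜 := ℝ)).const_mul 2
  let F : ℕ → (E d) → ℝ := fun n =>
    (ρ n).normed volume ⋆[ContinuousLinearMap.lsmul ℝ ℝ, volume] Ω.indicator u
  let g : (E d) → ℝ := fun x => limUnder atTop fun n => F n x
  have hFg : ∀ᵐ x, Tendsto (fun n => F n x) atTop (𝓝 (Ω.indicator u x)) :=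
    ContDiffBump.ae_convolution_tendsto_right_of_locallyIntegrable (K := 2) hρlim
      (.of_forall fun _ => le_rfl)
      ((integrable_indicator_iff hΩ.measurableSet).2 hint).locallyIntegrable
  have hg : ∀ᵐ x ∂(volume.restrict Ω), u x = g x := by
    filter_upwards [ae_restrict_of_ae hFg, ae_restrict_mem hΩ.measurableSet] with x hx hxΩ
    rw [Set.indicator_of_mem hxΩ] at hx
    exact hx.limUnder_eq.symm
  have hgder : ∀ x ∈ Ω, HasFDerivAt g (0 : (E d) →L[ℝ] ℝ) x := by
    intro x hx
    obtain ⟨r, hr, hball⟩ := Metric.isOpen_iff.1 hΩ x hx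
    have hconst : ∀ᶠ n in atTop, ∀ y ∈ Metric.ball x (r / 2), F n y = F n x := by
      filter_upwards [hρlim.eventually (gt_mem_nhds (half_pos hr))] with n hn y hy
      have hder : ∀ z ∈ Metric.ball x (r / 2), HasFDerivAt (F n) (0 : (E d) →L[ℝ] ℝ) z := by
        intro z hz
        refine hasFDerivAt_convolution_zero hΩ.measurableSet hint hu (ρ n).contDiff_normed
          ((ρ n).tsupport_normed_eq.subset) fun t ht => hball ?_
        rw [Metric.mem_closedBall] at ht
        rw [Metric.mem_ball] at hz ⊢
        linarith [dist_triangle t z x]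
      exact Metric.isOpen_ball.is_const_of_fderiv_eq_zero (𝕜 := ℝ)
        (convex_ball x (r / 2)).isPreconnected
        (fun z hz => (hder z hz).differentiableAt.differentiableWithinAt)
        (fun z hz => (hder z hz).fderiv) hy (Metric.mem_ball_self (half_pos hr))
    refine (hasFDerivAt_const (g x) x).congr_of_eventuallyEq ?_
    filter_upwards [Metric.ball_mem_nhds x (half_pos hr)] with y hy
    exact congrArg lim (map_congr (hconst.mono fun n hn => hn y hy))
  obtain ⟨c, hc⟩ := hΩ.exists_is_const_of_fderiv_eq_zero (𝕜 := ℝ) hconn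
    (fun x hx => (hgder x hx).differentiableAt.differentiableWithinAt)
    (fun x hx => (hgder x hx).fderiv)
  refine ⟨c, ?_⟩
  filter_upwards [hg, ae_restrict_mem hΩ.measurableSet] with x hx hxΩ
  rw [hx, hc x hxΩ]

/-! ### Shrinking an exactly recovered solution -/

/-- The cost per unit of `t`, at one point, of splitting the residual `t * s` between the two
fidelity terms: small residuals are charged to the `L²` term, large ones to the `L¹` term. -/
noncomputable def splitCost (lam1 lam2 t s : ℝ) : ℝ :=
  if |t * s| ≤ 1 then lam2 / 2 * (t * s ^ 2) else lam1 * |s|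

theorem splitCost_le {lam1 lam2 t : ℝ} (h1 : 0 ≤ lam1) (h2 : 0 ≤ lam2) (ht : 0 ≤ t) (s : ℝ) :
    splitCost lam1 lam2 t s ≤ (lam1 + lam2 / 2) * |s| := by
  unfold splitCost
  have hs := abs_nonneg s
  split_ifs with h
  · have : t * s ^ 2 ≤ |s| := by
      calc t * s ^ 2 = |t * s| * |s| := by rw [abs_mul, abs_of_nonneg ht, ← sq_abs]; ring
        _ ≤ 1 * |s| := by gcongr
        _ = |s| := one_mul _
    nlinarith [mul_nonneg h1 hs]
  · nlinarith [mul_nonneg h2 hs]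

theorem measurable_splitCost (lam1 lam2 t : ℝ) : Measurable (splitCost lam1 lam2 t) := by
  unfold splitCost
  exact Measurable.ite (measurableSet_le (by fun_prop) measurable_const) (by fun_prop)
    (by fun_prop)

theorem tendsto_splitCost (lam1 lam2 s : ℝ) :
    Tendsto (fun t => splitCost lam1 lam2 t s) (𝓝 0) (𝓝 0) := by
  have hsmall : ∀ᶠ t in 𝓝 (0 : ℝ), |t * s| ≤ 1 := by
    have : Tendsto (fun t : ℝ => |t * s|) (𝓝 0) (𝓝 0) :=
      Continuous.tendsto' (by fun_prop) _ _ (by simp)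
    filter_upwards [this.eventually (gt_mem_nhds one_pos)] with t ht using ht.le
  have hlim : Tendsto (fun t : ℝ => lam2 / 2 * (t * s ^ 2)) (𝓝 0) (𝓝 0) :=
    Continuous.tendsto' (by fun_prop) _ _ (by simp)
  refine hlim.congr' ?_
  filter_upwards [hsmall] with t ht
  rw [splitCost, if_pos ht]

/-- Comparison with `((1 - t) u, z)`, where `z` is `t u` cut off to `0` at the points where
`|t u| ≤ 1`. -/
theorem totalVariation_le_lintegral_splitCost {Ω : Set (E d)} {lam1 lam2 : ℝ} (h1 : 0 < lam1)
    (h2 : 0 < lam2) {f u : (E d) → ℝ} (hu : IsSolution Ω lam1 lam2 f u)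
    (huf : u =ᵐ[volume.restrict Ω] f) {t : ℝ} (ht : 0 < t) (ht1 : t ≤ 1) :
    totalVariation Ω u ≤ ∫⁻ x in Ω, ENNReal.ofReal (splitCost lam1 lam2 t (u x)) := by
  obtain ⟨v, ⟨hint, hfin⟩, -, hmin⟩ := hu
  let Z : ℝ → ℝ := fun s => if |s| ≤ 1 then 0 else s
  have hZm : Measurable Z :=
    Measurable.ite (measurableSet_le (by fun_prop) measurable_const) measurable_const measurable_id
  have hum : AEMeasurable u (volume.restrict Ω) := hint.1.aemeasurable
  have hwTV := totalVariation_const_mul_le Ω (sub_nonneg.2 ht1) u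
  have hw : IsBV Ω fun x => (1 - t) * u x :=
    ⟨hint.const_mul _, hwTV.trans_lt (ENNReal.mul_lt_top ENNReal.ofReal_lt_top hfin)⟩
  have hz : IntegrableOn (fun x => Z (t * u x)) Ω := by
    refine (hint.const_mul t).mono (hZm.comp_aemeasurable (hum.const_mul t)).aestronglyMeasurable
      (.of_forall fun x => ?_)
    simp only [Z]
    split_ifs
    · simpa using norm_nonneg (t * u x)
    · exact le_rfl
  have hle : totalVariation Ω u ≤ _ := (le_add_right le_self_add).trans (hmin _ _ hw hz)
  have hterm1 : ENNReal.ofReal lam1 * eLpNorm (fun x => Z (t * u x)) 1 (volume.restrict Ω)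
      = ∫⁻ x in Ω, ENNReal.ofReal (lam1 * |Z (t * u x)|) := by
    rw [eLpNorm_one_eq_lintegral_enorm, ← lintegral_const_mul' _ _ ENNReal.ofReal_ne_top]
    simp_rw [ENNReal.ofReal_mul h1.le, Real.enorm_eq_ofReal_abs]
  have hterm2 : ENNReal.ofReal (lam2 / 2) *
        eLpNorm (fun x => f x - (1 - t) * u x - Z (t * u x)) 2 (volume.restrict Ω) ^ 2
      = ∫⁻ x in Ω, ENNReal.ofReal (lam2 / 2 * (t * u x - Z (t * u x)) ^ 2) := by
    have hpow := eLpNorm_nnreal_pow_eq_lintegral (p := 2) (μ := volume.restrict Ω)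
      (f := fun x => f x - (1 - t) * u x - Z (t * u x)) two_ne_zero
    norm_num at hpow
    rw [hpow, ← lintegral_const_mul' _ _ ENNReal.ofReal_ne_top]
    refine lintegral_congr_ae ?_
    filter_upwards [huf] with x hx
    rw [ENNReal.ofReal_mul (by positivity), ← hx, Real.enorm_eq_ofReal_abs,
      ← ENNReal.ofReal_pow (abs_nonneg _), sq_abs]
    ring_nf
  have hsum : ENNReal.ofReal lam1 * eLpNorm (fun x => Z (t * u x)) 1 (volume.restrict Ω)
      + ENNReal.ofReal (lam2 / 2) *
        eLpNorm (fun x => f x - (1 - t) * u x - Z (t * u x)) 2 (volume.restrict Ω) ^ 2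
      = ENNReal.ofReal t * ∫⁻ x in Ω, ENNReal.ofReal (splitCost lam1 lam2 t (u x)) := by
    rw [hterm1, hterm2, ← lintegral_const_mul' _ _ ENNReal.ofReal_ne_top, ← lintegral_add_left']
    · refine lintegral_congr fun x => ?_
      rw [← ENNReal.ofReal_add (by positivity) (by positivity), ← ENNReal.ofReal_mul ht.le]
      congr 1
      simp only [splitCost, Z]
      split_ifs with h
      · simp; ring
      · rw [abs_mul, abs_of_pos ht]; ring
    · have := hZm.comp_aemeasurable (hum.const_mul t)
      simp only [Function.comp_def] at this
      fun_prop
  set T := totalVariation Ω u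
  set A := ∫⁻ x in Ω, ENNReal.ofReal (splitCost lam1 lam2 t (u x))
  rw [energy, add_assoc, hsum] at hle
  have hsplit : ENNReal.ofReal (1 - t) * T + ENNReal.ofReal t * T
      ≤ ENNReal.ofReal (1 - t) * T + ENNReal.ofReal t * A := by
    rw [← add_mul, ← ENNReal.ofReal_add (sub_nonneg.2 ht1) ht.le, sub_add_cancel,
      ENNReal.ofReal_one, one_mul]
    exact hle.trans (by gcongr)
  -- `T < ∞` is what allows cancelling `(1 - t) T`
  have hT := (ENNReal.add_le_add_iff_left
    (ENNReal.mul_ne_top ENNReal.ofReal_ne_top hfin.ne)).1 hsplit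
  exact (ENNReal.mul_le_mul_iff_right (ENNReal.ofReal_pos.2 ht).ne' ENNReal.ofReal_ne_top).1 hT

theorem totalVariation_eq_zero_of_ae_eq {Ω : Set (E d)} {lam1 lam2 : ℝ} (h1 : 0 < lam1)
    (h2 : 0 < lam2) {f u : (E d) → ℝ} (hu : IsSolution Ω lam1 lam2 f u)
    (huf : u =ᵐ[volume.restrict Ω] f) : totalVariation Ω u = 0 := by
  have hint : IntegrableOn u Ω := by
    obtain ⟨v, ⟨hint, -⟩, -⟩ := hu
    exact hint
  have hlim : Tendsto (fun n : ℕ =>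
      ∫⁻ x in Ω, ENNReal.ofReal (splitCost lam1 lam2 (1 / ((n : ℝ) + 1)) (u x)))
      atTop (𝓝 (∫⁻ _ in Ω, 0)) := by
    refine tendsto_lintegral_of_dominated_convergence'
      (fun x => ENNReal.ofReal ((lam1 + lam2 / 2) * |u x|)) (fun n => ?_) (fun n => ?_) ?_ ?_
    · exact ((measurable_splitCost _ _ _).comp_aemeasurable hint.1.aemeasurable).ennreal_ofReal
    · exact .of_forall fun x =>
        ENNReal.ofReal_le_ofReal (splitCost_le h1.le h2.le (by positivity) _)
    · exact (hint.abs.const_mul (lam1 + lam2 / 2)).lintegral_lt_top.ne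
    · refine .of_forall fun x => ?_
      simpa using (ENNReal.tendsto_ofReal
        ((tendsto_splitCost lam1 lam2 (u x)).comp tendsto_one_div_add_atTop_nhds_zero_nat))
  rw [lintegral_zero] at hlim
  refine le_antisymm (ge_of_tendsto' hlim fun n => ?_) zero_le
  refine totalVariation_le_lintegral_splitCost h1 h2 hu huf (by positivity) ?_
  exact div_le_one_of_le₀ (by linarith [n.cast_nonneg (α := ℝ)]) (by positivity)

/-! ### Constant data -/

theorem ae_eq_of_ae_eq_const {Ω : Set (E d)} (hΩ : Bornology.IsBounded Ω) {lam1 lam2 : ℝ}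
    (h1 : 0 < lam1) (h2 : 0 < lam2) {f u : (E d) → ℝ} (hf : IntegrableOn f Ω)
    (hu : IsSolution Ω lam1 lam2 f u) {c : ℝ} (hc : ∀ᵐ x ∂(volume.restrict Ω), f x = c) :
    u =ᵐ[volume.restrict Ω] f := by
  obtain ⟨v, ⟨hint, -⟩, hv, hmin⟩ := hu
  have hconst : IsBV Ω fun _ => c :=
    ⟨integrableOn_const hΩ.measure_lt_top.ne, by simp [totalVariation_const]⟩
  have hfc : (fun x => f x - c - 0) =ᵐ[volume.restrict Ω] 0 := by
    filter_upwards [hc] with x hx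
    simp [hx]
  have hzero : energy Ω lam1 lam2 f (fun _ => c) (fun _ => 0) = 0 := by
    rw [energy, eLpNorm_congr_ae hfc]
    simp [totalVariation_const]
  have h := (hmin _ _ hconst integrableOn_zero).trans_eq hzero
  simp only [energy, nonpos_iff_eq_zero, add_eq_zero, mul_eq_zero, ENNReal.ofReal_eq_zero,
    h1.not_ge, (half_pos h2).not_ge, false_or, pow_eq_zero_iff two_ne_zero] at h
  obtain ⟨⟨-, hv0⟩, hr0⟩ := h
  rw [eLpNorm_eq_zero_iff hv.1 one_ne_zero] at hv0
  replace hr0 := (eLpNorm_eq_zero_iff ((hf.1.sub hint.1).sub hv.1) two_ne_zero).1 hr0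
  filter_upwards [hv0, hr0] with x hx hx'
  simp only [Pi.zero_apply, Pi.sub_apply] at hx hx'
  linarith

end TVIC

theorem proposition2p10 (d : ℕ) (Ω : Set (EuclideanSpace ℝ (Fin d)))
    (hΩ_open : IsOpen Ω) (hΩ_bdd : Bornology.IsBounded Ω) (hΩ_conn : IsConnected Ω)
    (lam1 lam2 : ℝ) (hlam1 : 0 < lam1) (hlam2 : 0 < lam2)
    (f u : EuclideanSpace ℝ (Fin d) → ℝ) (hf : IntegrableOn f Ω)
    (hu : TVIC.IsSolution Ω lam1 lam2 f u) :
    (∀ᵐ x ∂(volume.restrict Ω), u x = f x) ↔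
      ∃ c : ℝ, ∀ᵐ x ∂(volume.restrict Ω), f x = c := by
  constructor
  · intro huf
    have hTV := (TVIC.totalVariation_congr_ae huf).symm.trans
      (TVIC.totalVariation_eq_zero_of_ae_eq hlam1 hlam2 hu huf)
    exact TVIC.exists_ae_eq_const_of_totalVariation_eq_zero hΩ_open hΩ_conn.isPreconnected hf hTV
  · rintro ⟨c, hc⟩
    exact TVIC.ae_eq_of_ae_eq_const hΩ_bdd hlam1 hlam2 hf hu hc
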